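/- For real $a,b$ and $n\in\mathbb N_0$ let $$P_n^{(a,b)}(x)=\sum_{k=0}^n \frac{(n+a+b+1)_k\,(a+k+1)_{n-k}}{k!\,(n-k)!}\Big(\frac{x-1}{2}\Big)^k$$ be the Jacobi polynomial, and for $\lambda>0$ let $$C_n^{\lambda}(x)=\sum_{k=0}^n \frac{(2\lambda)_{n+k}}{(\lambda+\frac12)_k\,k!\,(n-k)!}\Big(\frac{x-1}{2}\Big)^k$$ be the Gegenbauer polynomial, where $(c)_k=c(c+1)\cdots(c+k-1)$. For $\alpha,\beta\in\mathbb N_0$ and $t>0$ put $$F_n^{(\alpha,\beta),\delta}(t)=\int_0^t (t-\theta)^\delta P_n^{(\alpha-\frac12,\beta-\frac12)}(\cos\theta)\Big(\sin\frac\theta2\Big)^{2\alpha}\Big(\cos\frac\theta2\Big)^{2\beta}d\theta ,$$ and for $\lambda>0$ and $0<t\le\pi$ put $$F_n^{\lambda,\delta}(t)=\int_0^t (t-\theta)^\delta C_n^\lambda(\cos\theta)(\sin\theta)^{2\lambda}\,d\theta .$$ 1. Let $\alpha,\beta\in\mathbb N_0$ be not both zero and let $\delta\ge\alpha+1$ be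 real. Then $F_n^{(\alpha,\beta),\delta}(t)>0$ for every $t>0$ and every $n\in\mathbb N_0$, the case in which $\alpha=0$, $\delta=1$, $n\ge1$ and $t\in 2\pi\mathbb N$ being excluded. 2. For every real $\delta\ge1$, $F_n^{(0,0),\delta}(t)\ge0$ for every $t>0$ and every $n\in\mathbb N_0$. 3. In particular, the conjecture of Beatson, zu Castell and Xu holds for every positive integer $\lambda$: for every real $\delta\ge\lambda+1$, $F_n^{\lambda,\delta}(t)>0$ for all $t\in(0,\pi]$ and all $n\in\mathbb N_0$. -/

import Mathlib

/-- The Jacobi polynomial `P_n^{(a,b)}(x)`, in its standard normalisation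
`P_n^{(a,b)}(1) = (a+1)_n / n!`, given by its expansion at `x = 1`:
`∑_{k=0}^n (n+a+b+1)_k (a+k+1)_{n-k} / (k! (n-k)!) ((x-1)/2)^k`
`= ((a+1)_n / n!) ₂F₁(-n, n+a+b+1; a+1; (1-x)/2)`,
with `(c)_k` the rising factorial. -/
noncomputable def jacobiP (n : ℕ) (a b x : ℝ) : ℝ :=
  ∑ k ∈ Finset.range (n + 1),
    (ascPochhammer ℝ k).eval ((n : ℝ) + a + b + 1)
      * (ascPochhammer ℝ (n - k)).eval (a + (k : ℝ) + 1)
      / ((k.factorial : ℝ) * ((n - k).factorial : ℝ)) * ((x - 1) / 2) ^ k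

/-- The Gegenbauer polynomial `C_n^{lam}(x)` (for `lam > 0`), in its standard normalisation
`C_n^{lam}(1) = (2 lam)_n / n!`, given by its expansion at `x = 1`:
`∑_{k=0}^n (2 lam)_{n+k} / ((lam+1/2)_k k! (n-k)!) ((x-1)/2)^k`
`= ((2 lam)_n / n!) ₂F₁(-n, n+2 lam; lam+1/2; (1-x)/2)`. -/
noncomputable def gegenbauerC (n : ℕ) (lam x : ℝ) : ℝ :=
  ∑ k ∈ Finset.range (n + 1),
    (ascPochhammer ℝ (n + k)).eval (2 * lam)
      / ((ascPochhammer ℝ k).eval (lam + 1 / 2)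
          * (k.factorial : ℝ) * ((n - k).factorial : ℝ)) * ((x - 1) / 2) ^ k

/-- `F_n^{(α,β),δ}(t) = ∫_0^t (t-θ)^δ P_n^{(α-1/2,β-1/2)}(cos θ) (sin θ/2)^{2α} (cos θ/2)^{2β} dθ`
for nonnegative integers `α`, `β` and real `δ`. -/
noncomputable def jacobiIntegral (α β : ℕ) (δ : ℝ) (n : ℕ) (t : ℝ) : ℝ :=
  ∫ θ in (0 : ℝ)..t,
    (t - θ) ^ δ * jacobiP n ((α : ℝ) - 1 / 2) ((β : ℝ) - 1 / 2) (Real.cos θ)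
      * Real.sin (θ / 2) ^ (2 * α) * Real.cos (θ / 2) ^ (2 * β)

/-- `F_n^{lam,δ}(t) = ∫_0^t (t-θ)^δ C_n^{lam}(cos θ) (sin θ)^{2 lam} dθ` for real `lam > 0`,
`δ > 0` and `0 < t ≤ π`. -/
noncomputable def gegenbauerIntegral (lam δ : ℝ) (n : ℕ) (t : ℝ) : ℝ :=
  ∫ θ in (0 : ℝ)..t,
    (t - θ) ^ δ * gegenbauerC n lam (Real.cos θ) * Real.sin θ ^ (2 * lam)

/-! Write `I` for integration from `0`. Integrating by parts moves the factor `(t - θ)^δ` onto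
iterated primitives of the weighted Jacobi polynomial, so everything reduces to the sign of its
primitive of order `α + 2`: for `δ = α + 1` the integral is a positive multiple of that primitive,
and for larger `δ` it is a fractional integral of it, with exponent above `-1`.

The contiguous relation in `b` writes the weighted polynomial for `β + 1` as a positive combination
of two for `β`, so `β = 0` suffices. The relation in `a` is a difference in `n`. Since the case `α =
β = 0` is a multiple of `cos (n θ)`, the case `β = 0` is a positive multiple of `D_α`, the divided
difference of order `α` of `n ↦ cos (n θ)` at the nodes `n²`, up to sign convention.

As `cos (n θ)` has eigenvalue `-n²` under `d²/dθ²`, the Leibniz rule gives `D_{a+1}'' + ν² D_{a+1} =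
D_a` with `ν = n + a + 1` and zero initial data. Variation of constants then yields `I^{a+3} D_{a+1}
= (I^{a+2} D_a) * (1 - cos ν·)/ν²`, a convolution of nonnegative functions. The base `I² cos (n ·)`
is `(1 - cos nt)/n²` or `t²/2`. All zeros are countable, so each convolution is strictly positive;
only `α = 0` leaves zeros to examine. -/

/-! ### Contiguous relations for Jacobi polynomials -/

/-- The coefficient of `((x - 1) / 2) ^ k` in the Jacobi polynomial. -/
noncomputable def jacobiCoeff (n : ℕ) (a b : ℝ) (k : ℕ) : ℝ :=
  (ascPochhammer ℝ k).eval ((n : ℝ) + a + b + 1)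
      * (ascPochhammer ℝ (n - k)).eval (a + (k : ℝ) + 1)
      / ((k.factorial : ℝ) * ((n - k).factorial : ℝ))

theorem jacobiP_eq_sum (n : ℕ) (a b x : ℝ) :
    jacobiP n a b x = ∑ k ∈ Finset.range (n + 1), jacobiCoeff n a b k * ((x - 1) / 2) ^ k := rfl

theorem ascPochhammer_eval_succ_left (k : ℕ) (c : ℝ) :
    (ascPochhammer ℝ (k + 1)).eval c = c * (ascPochhammer ℝ k).eval (c + 1) := by
  simp [ascPochhammer_succ_left, Polynomial.eval_comp]

theorem ascPochhammer_eval_add (n k : ℕ) (c : ℝ) :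
    (ascPochhammer ℝ (n + k)).eval c
      = (ascPochhammer ℝ n).eval c * (ascPochhammer ℝ k).eval (c + n) := by
  rw [← ascPochhammer_mul]
  simp [Polynomial.eval_comp]

theorem jacobiP_eq_lower (n : ℕ) (a b x : ℝ) :
    jacobiP n a b x = jacobiCoeff n a b 0
      + ∑ k ∈ Finset.range n, jacobiCoeff n a b (k + 1) * ((x - 1) / 2) ^ (k + 1) := by
  rw [jacobiP_eq_sum, Finset.sum_range_succ']
  simp [add_comm]

theorem jacobiP_eq_upper (n : ℕ) (a b x : ℝ) :
    jacobiP n a b x = ∑ k ∈ Finset.range n, jacobiCoeff n a b k * ((x - 1) / 2) ^ k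
      + jacobiCoeff n a b n * ((x - 1) / 2) ^ n := by
  rw [jacobiP_eq_sum, Finset.sum_range_succ]

theorem jacobiCoeff_zero_succ (n : ℕ) (a b : ℝ) :
    ((n : ℝ) + 1) * jacobiCoeff (n + 1) a b 0 = (n + a + 1) * jacobiCoeff n a b 0 := by
  have := Nat.factorial_pos n
  simp only [jacobiCoeff, Nat.sub_zero, ascPochhammer_succ_eval, Nat.factorial_succ]
  simp
  field_simp
  ring

theorem jacobiCoeff_zero_right (n : ℕ) (a b b' : ℝ) :
    jacobiCoeff n a b 0 = jacobiCoeff n a b' 0 := by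
  simp [jacobiCoeff]

theorem jacobiCoeff_contiguous_left (n k : ℕ) (hk : k < n) (a b : ℝ) :
    -(2 * n + a + b + 2) * jacobiCoeff n (a + 1) b k
      = (n + a + 1) * jacobiCoeff n a b (k + 1) - (n + 1) * jacobiCoeff (n + 1) a b (k + 1) := by
  obtain ⟨m, rfl⟩ : ∃ m, n = k + m + 1 := ⟨n - k - 1, by omega⟩
  have e1 : k + m + 1 - k = m + 1 := by omega
  have e2 : k + m + 1 - (k + 1) = m := by omega
  have e3 : k + m + 1 + 1 - (k + 1) = m + 1 := by omega
  simp only [jacobiCoeff, e1, e2, e3]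
  push_cast
  rw [show a + 1 + (k : ℝ) + 1 = a + k + 2 by ring, show a + ((k : ℝ) + 1) + 1 = a + k + 2 by ring,
    show (k : ℝ) + m + 1 + (a + 1) + b + 1 = k + m + a + b + 3 by ring,
    show (k : ℝ) + m + 1 + 1 + a + b + 1 = k + m + a + b + 3 by ring,
    ascPochhammer_eval_succ_left k, ascPochhammer_succ_eval, ascPochhammer_succ_eval,
    show (k : ℝ) + m + 1 + a + b + 1 + 1 = k + m + a + b + 3 by ring]
  simp only [Nat.factorial_succ]
  push_cast
  have := Nat.factorial_pos m
  have := Nat.factorial_pos k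
  field_simp
  ring

theorem jacobiCoeff_contiguous_left_top (n : ℕ) (a b : ℝ) :
    (2 * n + a + b + 2) * jacobiCoeff n (a + 1) b n = (n + 1) * jacobiCoeff (n + 1) a b (n + 1) := by
  simp only [jacobiCoeff, Nat.sub_self]
  push_cast
  rw [show (n : ℝ) + (a + 1) + b + 1 = n + a + b + 2 by ring,
    show (n : ℝ) + 1 + a + b + 1 = n + a + b + 2 by ring, ascPochhammer_succ_eval]
  simp only [Nat.factorial_succ, ascPochhammer_zero, Polynomial.eval_one, Nat.factorial_zero]
  push_cast
  have := Nat.factorial_pos n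
  field_simp
  ring

theorem jacobiCoeff_contiguous_right (n k : ℕ) (hk : k < n) (a b : ℝ) :
    (2 * n + a + b + 2) * (jacobiCoeff n a (b + 1) (k + 1) + jacobiCoeff n a (b + 1) k)
      = (n + b + 1) * jacobiCoeff n a b (k + 1) + (n + 1) * jacobiCoeff (n + 1) a b (k + 1) := by
  obtain ⟨m, rfl⟩ : ∃ m, n = k + m + 1 := ⟨n - k - 1, by omega⟩
  have e1 : k + m + 1 - k = m + 1 := by omega
  have e2 : k + m + 1 - (k + 1) = m := by omega
  have e3 : k + m + 1 + 1 - (k + 1) = m + 1 := by omega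
  simp only [jacobiCoeff, e1, e2, e3]
  push_cast
  rw [show a + ((k : ℝ) + 1) + 1 = a + k + 1 + 1 by ring, ascPochhammer_eval_succ_left m (a + k + 1),
    show (k : ℝ) + m + 1 + a + (b + 1) + 1 = k + m + a + b + 3 by ring,
    show (k : ℝ) + m + 1 + 1 + a + b + 1 = k + m + a + b + 3 by ring,
    ascPochhammer_eval_succ_left k (k + m + 1 + a + b + 1), ascPochhammer_succ_eval,
    ascPochhammer_succ_eval, show (k : ℝ) + m + 1 + a + b + 1 + 1 = k + m + a + b + 3 by ring]
  simp only [Nat.factorial_succ]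
  push_cast
  have := Nat.factorial_pos m
  have := Nat.factorial_pos k
  field_simp
  ring

theorem jacobiCoeff_contiguous_right_top (n : ℕ) (a b : ℝ) :
    (2 * n + a + b + 2) * jacobiCoeff n a (b + 1) n = (n + 1) * jacobiCoeff (n + 1) a b (n + 1) := by
  rw [← jacobiCoeff_contiguous_left_top]
  simp [jacobiCoeff, add_right_comm, ← add_assoc]

/-- The contiguous relation raising the first parameter. -/
theorem jacobiP_contiguous_left (n : ℕ) (a b x : ℝ) :
    (2 * n + a + b + 2) * ((1 - x) / 2) * jacobiP n (a + 1) b x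
      = (n + a + 1) * jacobiP n a b x - (n + 1) * jacobiP (n + 1) a b x := by
  rw [jacobiP_eq_upper n (a + 1), jacobiP_eq_lower n a, jacobiP_eq_lower (n + 1) a,
    Finset.sum_range_succ]
  have h : ∑ k ∈ Finset.range n,
        (-(2 * n + a + b + 2) * jacobiCoeff n (a + 1) b k) * ((x - 1) / 2) ^ (k + 1)
      = ∑ k ∈ Finset.range n, ((n + a + 1) * jacobiCoeff n a b (k + 1)
        - (n + 1) * jacobiCoeff (n + 1) a b (k + 1)) * ((x - 1) / 2) ^ (k + 1) :=
    Finset.sum_congr rfl fun k hk ↦ by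
      rw [jacobiCoeff_contiguous_left n k (Finset.mem_range.mp hk)]
  simp only [sub_mul, Finset.sum_sub_distrib, mul_assoc, ← Finset.mul_sum, pow_succ,
    mul_comm _ ((x - 1) / 2), mul_left_comm _ ((x - 1) / 2)] at h ⊢
  linear_combination h + jacobiCoeff_zero_succ n a b
    - ((x - 1) / 2) ^ (n + 1) * jacobiCoeff_contiguous_left_top n a b

/-- The contiguous relation raising the second parameter. -/
theorem jacobiP_contiguous_right (n : ℕ) (a b x : ℝ) :
    (2 * n + a + b + 2) * ((1 + x) / 2) * jacobiP n a (b + 1) x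
      = (n + b + 1) * jacobiP n a b x + (n + 1) * jacobiP (n + 1) a b x := by
  -- Splitting `(1 + x)/2 = 1 + (x - 1)/2` produces two copies of the sum, the second shifted by one
  -- degree; hence the two different expansions below.
  have e : (2 * n + a + b + 2) * ((1 + x) / 2) * jacobiP n a (b + 1) x
      = (2 * n + a + b + 2) * jacobiP n a (b + 1) x
        + (2 * n + a + b + 2) * ((x - 1) / 2) * jacobiP n a (b + 1) x := by ring
  rw [e]
  nth_rw 1 [jacobiP_eq_lower n a (b + 1)]
  rw [jacobiP_eq_upper n a (b + 1), jacobiP_eq_lower n a b, jacobiP_eq_lower (n + 1) a,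
    Finset.sum_range_succ]
  have h : ∑ k ∈ Finset.range n, ((2 * n + a + b + 2)
        * (jacobiCoeff n a (b + 1) (k + 1) + jacobiCoeff n a (b + 1) k)) * ((x - 1) / 2) ^ (k + 1)
      = ∑ k ∈ Finset.range n, ((n + b + 1) * jacobiCoeff n a b (k + 1)
        + (n + 1) * jacobiCoeff (n + 1) a b (k + 1)) * ((x - 1) / 2) ^ (k + 1) :=
    Finset.sum_congr rfl fun k hk ↦ by
      rw [jacobiCoeff_contiguous_right n k (Finset.mem_range.mp hk)]
  simp only [add_mul (_ * _), add_mul (jacobiCoeff _ _ _ _), Finset.sum_add_distrib, mul_assoc, ← Finset.mul_sum, pow_succ,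
    mul_comm _ ((x - 1) / 2), mul_left_comm _ ((x - 1) / 2)] at h ⊢
  have h0 := jacobiCoeff_zero_right n a (b + 1) b
  linear_combination h - jacobiCoeff_zero_succ n a b
    + ((x - 1) / 2) ^ (n + 1) * jacobiCoeff_contiguous_right_top n a b
    + (2 * n + a + b + 2) * h0

/-! ### Chebyshev and Gegenbauer polynomials as Jacobi polynomials -/

theorem ascPochhammer_half_eval (k : ℕ) :
    2 ^ k * (ascPochhammer ℝ k).eval (1 / 2 : ℝ) = ∏ l ∈ Finset.range k, (2 * (l : ℝ) + 1) := by
  induction k with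
  | zero => simp
  | succ k ih => rw [Finset.prod_range_succ, ← ih, ascPochhammer_succ_eval]; ring

/-- Each factor splits as `(n - l)(n + l)`. This turns the derivatives of the Chebyshev polynomial
at `1` into Pochhammer symbols. -/
theorem prod_range_sq_sub_sq (n k : ℕ) (hk : k ≤ n) :
    ((n - k).factorial : ℝ) * ∏ l ∈ Finset.range k, ((n : ℝ) ^ 2 - (l : ℝ) ^ 2)
      = n.factorial * (ascPochhammer ℝ k).eval (n : ℝ) := by
  induction k with
  | zero => simp
  | succ k ih =>
    have hf : n - k = (n - (k + 1)) + 1 := by omega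
    have := ih (by omega)
    rw [hf, Nat.factorial_succ, ← hf] at this
    push_cast [Nat.cast_sub (show k ≤ n by omega)] at this
    rw [Finset.prod_range_succ, ascPochhammer_succ_eval]
    linear_combination ((n : ℝ) + k) * this

/-- The Jacobi polynomials with both parameters `-1/2` are multiples of Chebyshev polynomials. -/
theorem jacobiP_neg_half (n : ℕ) (x : ℝ) :
    jacobiP n (-(1 / 2)) (-(1 / 2)) x
      = (ascPochhammer ℝ n).eval (1 / 2 : ℝ) / n.factorial
        * (Polynomial.Chebyshev.T ℝ n).eval x := by
  have hT : (Polynomial.Chebyshev.T ℝ n).eval x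
      = ∑ k ∈ Finset.range (n + 1),
        ((Polynomial.derivative^[k] (Polynomial.Chebyshev.T ℝ n)).eval 1 / k.factorial)
          * (x - 1) ^ k := by
    have h1 := Polynomial.sum_taylor_eq (Polynomial.Chebyshev.T ℝ n) 1
    have hd : (Polynomial.taylor 1 (Polynomial.Chebyshev.T ℝ n)).natDegree < n + 1 := by
      simp
    rw [Polynomial.sum_over_range' _ (by simp) _ hd] at h1
    nth_rw 1 [← h1]
    rw [Polynomial.eval_finsetSum]
    refine Finset.sum_congr rfl fun k _ ↦ ?_
    rw [Polynomial.taylor_coeff, ← Polynomial.factorial_smul_hasseDeriv]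
    have := Nat.factorial_pos k
    simp
    left
    field_simp
  rw [hT, jacobiP_eq_sum, Finset.mul_sum]
  refine Finset.sum_congr rfl fun k hk ↦ ?_
  have hk : k ≤ n := by simpa [Nat.lt_succ_iff] using hk
  have h1 := Polynomial.Chebyshev.iterate_derivative_T_eval_one (R := ℝ) n k
  have h2 := prod_range_sq_sub_sq n k hk
  have h3 := ascPochhammer_half_eval k
  have h4 := ascPochhammer_eval_add k (n - k) (1 / 2)
  rw [Nat.add_sub_cancel' hk] at h4
  push_cast at h1
  rw [← h3] at h1
  rw [← h1] at h2
  have p := ascPochhammer_pos (S := ℝ) k (1 / 2) (by norm_num)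
  rw [jacobiCoeff, show (n : ℝ) + -(1 / 2) + -(1 / 2) + 1 = n by ring,
    show -(1 / 2) + (k : ℝ) + 1 = 1 / 2 + k by ring, h4, div_pow]
  have := Nat.factorial_pos k
  have := Nat.factorial_pos n
  have := Nat.factorial_pos (n - k)
  generalize (ascPochhammer ℝ (n - k)).eval (1 / 2 + k : ℝ) = q
  field_simp
  linear_combination -q * (x - 1) ^ k * h2

/-- Termwise, from `(2λ)_{n+k} = (2λ)_n (2λ+n)_k` and `(λ+1/2)_n = (λ+1/2)_k (λ+1/2+k)_{n-k}`. -/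
theorem gegenbauerC_eq_jacobiP (n : ℕ) (lam x : ℝ) (h : 0 < lam) :
    gegenbauerC n lam x
      = (ascPochhammer ℝ n).eval (2 * lam) / (ascPochhammer ℝ n).eval (lam + 1 / 2)
        * jacobiP n (lam - 1 / 2) (lam - 1 / 2) x := by
  rw [jacobiP_eq_sum, gegenbauerC, Finset.mul_sum]
  refine Finset.sum_congr rfl fun k hk ↦ ?_
  have hk : k ≤ n := by simpa [Nat.lt_succ_iff] using hk
  have h4 := ascPochhammer_eval_add k (n - k) (lam + 1 / 2)
  rw [Nat.add_sub_cancel' hk] at h4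
  have p := ascPochhammer_pos (S := ℝ) k (lam + 1 / 2) (by linarith)
  have q := ascPochhammer_pos (S := ℝ) (n - k) (lam + 1 / 2 + k) (by positivity)
  rw [jacobiCoeff, show (n : ℝ) + (lam - 1 / 2) + (lam - 1 / 2) + 1 = 2 * lam + n by ring,
    show lam - 1 / 2 + (k : ℝ) + 1 = lam + 1 / 2 + k by ring, h4, ascPochhammer_eval_add]
  have := Nat.factorial_pos k
  have := Nat.factorial_pos (n - k)
  generalize (ascPochhammer ℝ (n - k)).eval (lam + 1 / 2 + k : ℝ) = q at *
  generalize (ascPochhammer ℝ k).eval (lam + 1 / 2 : ℝ) = p at *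
  field_simp

/-! ### Iterated primitives and fractional integrals -/

open MeasureTheory Set

/-- The primitive of `f` vanishing at `0`. -/
noncomputable def primitive (f : ℝ → ℝ) (t : ℝ) : ℝ := ∫ s in (0 : ℝ)..t, f s

theorem primitive_zero (f : ℝ → ℝ) : primitive f 0 = 0 := by simp [primitive]

theorem hasDerivAt_primitive {f : ℝ → ℝ} (hf : Continuous f) (t : ℝ) :
    HasDerivAt (primitive f) (f t) t :=
  intervalIntegral.integral_hasDerivAt_right (hf.intervalIntegrable _ _)
    (hf.stronglyMeasurableAtFilter _ _) hf.continuousAt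

theorem continuous_primitive {f : ℝ → ℝ} (hf : Continuous f) : Continuous (primitive f) :=
  continuous_iff_continuousAt.mpr fun t ↦ (hasDerivAt_primitive hf t).continuousAt

theorem continuous_primitive_iterate {f : ℝ → ℝ} (hf : Continuous f) (m : ℕ) :
    Continuous (primitive^[m] f) := by
  induction m with
  | zero => exact hf
  | succ m ih => rw [Function.iterate_succ_apply']; exact continuous_primitive ih

theorem primitive_deriv {f f' : ℝ → ℝ} (hf : ∀ t, HasDerivAt f (f' t) t) (hf' : Continuous f')
    (h0 : f 0 = 0) : primitive f' = f := by
  ext t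
  rw [primitive, intervalIntegral.integral_eq_sub_of_hasDerivAt (fun x _ ↦ hf x)
    (hf'.intervalIntegrable _ _), h0, sub_zero]

theorem primitive_iterate_lincomb {f g : ℝ → ℝ} (hf : Continuous f) (hg : Continuous g)
    (c d : ℝ) (m : ℕ) :
    primitive^[m] (fun x ↦ c * f x + d * g x)
      = fun x ↦ c * primitive^[m] f x + d * primitive^[m] g x := by
  induction m with
  | zero => rfl
  | succ m ih =>
    simp only [Function.iterate_succ_apply', ih]
    ext t
    have h1 := (continuous_primitive_iterate hf m).intervalIntegrable (μ := volume) 0 t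
    have h2 := (continuous_primitive_iterate hg m).intervalIntegrable (μ := volume) 0 t
    simp only [primitive]
    rw [intervalIntegral.integral_add (h1.const_mul c) (h2.const_mul d),
      intervalIntegral.integral_const_mul, intervalIntegral.integral_const_mul]

/-- The unnormalised fractional integral `∫_0^t (t - θ)^δ g(θ) dθ`. -/
noncomputable def fracIntegral (δ : ℝ) (g : ℝ → ℝ) (t : ℝ) : ℝ :=
  ∫ θ in (0 : ℝ)..t, (t - θ) ^ δ * g θ

theorem fracIntegral_zero (g : ℝ → ℝ) : fracIntegral 0 g = primitive g := by
  ext t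
  simp [fracIntegral, primitive]

theorem intervalIntegrable_sub_rpow {ε : ℝ} (hε : -1 < ε) (t : ℝ) :
    IntervalIntegrable (fun θ ↦ (t - θ) ^ ε) volume 0 t := by
  have := (intervalIntegral.intervalIntegrable_rpow' (a := t) (b := 0) hε).comp_sub_left t
  simpa using this

theorem fracIntegral_eq_primitive {δ : ℝ} (hδ : 0 < δ) {g : ℝ → ℝ} (hg : Continuous g) {t : ℝ}
    (ht : 0 ≤ t) : fracIntegral δ g t = δ * fracIntegral (δ - 1) (primitive g) t := by
  have h := intervalIntegral.integral_mul_deriv_eq_deriv_mul_of_hasDerivAt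
    (a := 0) (b := t) (u := fun θ ↦ (t - θ) ^ δ) (v := primitive g)
    (u' := fun θ ↦ -δ * (t - θ) ^ (δ - 1)) (v' := g)
    ((continuous_const.sub continuous_id).rpow_const fun _ ↦ Or.inr hδ.le).continuousOn
    (continuous_primitive hg).continuousOn
    (fun x hx ↦ by
      rw [min_eq_left ht, max_eq_right ht] at hx
      have h := ((hasDerivAt_id x).const_sub t).rpow_const (p := δ)
        (Or.inl (sub_pos.mpr hx.2).ne')
      exact h.congr_deriv (by simp))
    (fun x _ ↦ hasDerivAt_primitive hg x)
    ((intervalIntegrable_sub_rpow (by linarith) t).const_mul _)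
    (hg.intervalIntegrable _ _)
  rw [fracIntegral, h, primitive_zero, sub_self, Real.zero_rpow hδ.ne', fracIntegral]
  simp only [mul_assoc, intervalIntegral.integral_const_mul]
  ring

/-- Integration by parts `m` times; the boundary terms vanish, and the constant `(ε+1)⋯(ε+m)` does
not depend on `g`. -/
theorem exists_fracIntegral_add_nat {ε : ℝ} (hε : -1 < ε) (m : ℕ) :
    ∃ C : ℝ, 0 < C ∧ ∀ g : ℝ → ℝ, Continuous g → ∀ t : ℝ, 0 ≤ t →
      fracIntegral (ε + m) g t = C * fracIntegral ε (primitive^[m] g) t := by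
  induction m with
  | zero => exact ⟨1, one_pos, by simp⟩
  | succ m ih =>
    obtain ⟨C, hC, h⟩ := ih
    have hp : 0 < ε + (m + 1 : ℕ) := by
      push_cast
      have : (0 : ℝ) ≤ m := m.cast_nonneg
      linarith
    refine ⟨(ε + (m + 1 : ℕ)) * C, mul_pos hp hC, fun g hg t ht ↦ ?_⟩
    rw [fracIntegral_eq_primitive hp hg ht,
      show ε + (m + 1 : ℕ) - 1 = ε + m by push_cast; ring, h _ (continuous_primitive hg) _ ht,
      Function.iterate_succ_apply, mul_assoc]

/-! ### Positivity up to countably many zeros -/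

theorem intervalIntegral_pos_of_countable_zeros {f : ℝ → ℝ} {t : ℝ} (ht : 0 < t)
    (hfi : IntervalIntegrable f volume 0 t) (hf : ∀ x ∈ Ioo 0 t, 0 ≤ f x)
    (hc : {x | x ∈ Ioo 0 t ∧ f x = 0}.Countable) : 0 < ∫ x in (0 : ℝ)..t, f x := by
  have h₀ : 0 ≤ᵐ[volume.restrict (uIoc 0 t)] f := by
    rw [Filter.EventuallyLE, uIoc_of_le ht.le]
    refine ae_restrict_of_ae_eq_of_ae_restrict Ioo_ae_eq_Ioc ?_
    rw [ae_restrict_iff' measurableSet_Ioo]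
    filter_upwards with x hx using hf x hx
  rw [intervalIntegral.integral_pos_iff_support_of_nonneg_ae' h₀ hfi]
  refine ⟨ht, ?_⟩
  have hs : Ioo 0 t \ {x | x ∈ Ioo 0 t ∧ f x = 0} ⊆ Function.support f ∩ Ioc 0 t :=
    fun x hx ↦ ⟨fun h ↦ hx.2 ⟨hx.1, h⟩, Ioo_subset_Ioc_self hx.1⟩
  refine lt_of_lt_of_le ?_ (measure_mono hs)
  rw [measure_sdiff_null (hc.measure_zero _)]
  simpa using ht

/-- A continuous function that is nonnegative on `[0, ∞)` with countably many positive zeros. -/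
structure EssPos (f : ℝ → ℝ) : Prop where
  continuous : Continuous f
  nonneg : ∀ t, 0 ≤ t → 0 ≤ f t
  countable : {t | 0 < t ∧ f t = 0}.Countable

theorem EssPos.add_mul {f g : ℝ → ℝ} (hf : EssPos f) (hg : EssPos g) {c d : ℝ} (hc : 0 < c)
    (hd : 0 ≤ d) : EssPos fun x ↦ c * f x + d * g x where
  continuous := (continuous_const.mul hf.continuous).add (continuous_const.mul hg.continuous)
  nonneg t ht := add_nonneg (mul_nonneg hc.le (hf.nonneg t ht)) (mul_nonneg hd (hg.nonneg t ht))
  countable := by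
    refine hf.countable.mono ?_
    rintro t ⟨ht, h⟩
    refine ⟨ht, ?_⟩
    have h1 := mul_nonneg hc.le (hf.nonneg t ht.le)
    have h2 := mul_nonneg hd (hg.nonneg t ht.le)
    have : c * f t = 0 := by linarith
    exact (mul_eq_zero.mp this).resolve_left hc.ne'

theorem EssPos.of_pos {f : ℝ → ℝ} (hf : Continuous f) (h0 : 0 ≤ f 0) (h : ∀ t, 0 < t → 0 < f t) :
    EssPos f where
  continuous := hf
  nonneg t ht := ht.eq_or_lt.elim (fun e ↦ e ▸ h0) fun h' ↦ (h t h').le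
  countable := by
    convert countable_empty (α := ℝ)
    ext t
    simpa using fun ht ↦ (h t ht).ne'

theorem EssPos.fracIntegral_pos {f : ℝ → ℝ} (hf : EssPos f) {ε : ℝ} (hε : -1 < ε) {t : ℝ}
    (ht : 0 < t) : 0 < fracIntegral ε f t := by
  refine intervalIntegral_pos_of_countable_zeros ht
    ((intervalIntegrable_sub_rpow hε t).mul_continuousOn hf.continuous.continuousOn)
    (fun x hx ↦ mul_nonneg (Real.rpow_nonneg (sub_nonneg.mpr hx.2.le) _) (hf.nonneg x hx.1.le))
    (hf.countable.mono ?_)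
  rintro x ⟨hx, h⟩
  exact ⟨hx.1, (mul_eq_zero.mp h).resolve_left (Real.rpow_pos_of_pos (sub_pos.mpr hx.2) _).ne'⟩

theorem countable_cos_mul_eq_one {ν : ℝ} (hν : ν ≠ 0) : {x | Real.cos (ν * x) = 1}.Countable := by
  refine (countable_range fun k : ℤ ↦ k * (2 * Real.pi) / ν).mono ?_
  intro x hx
  obtain ⟨k, hk⟩ := (Real.cos_eq_one_iff _).mp hx
  exact ⟨k, by simp only [hk]; field_simp⟩

theorem essPos_one_sub_cos {ν : ℝ} (hν : ν ≠ 0) :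
    EssPos fun x ↦ (1 - Real.cos (ν * x)) / ν ^ 2 where
  continuous := by fun_prop
  nonneg t _ := div_nonneg (sub_nonneg.mpr (Real.cos_le_one _)) (sq_nonneg _)
  countable := by
    refine (countable_cos_mul_eq_one hν).mono ?_
    rintro t ⟨_, h⟩
    have := (div_eq_zero_iff.mp h).resolve_right (pow_ne_zero 2 hν)
    change _ = _
    linarith

theorem EssPos.convolution_pos {f g : ℝ → ℝ} (hf : EssPos f) (hg : EssPos g) {t : ℝ}
    (ht : 0 < t) : 0 < ∫ s in (0 : ℝ)..t, f s * g (t - s) := by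
  refine intervalIntegral_pos_of_countable_zeros ht
    (hf.continuous.mul (hg.continuous.comp
      (continuous_const.sub continuous_id))).continuousOn.intervalIntegrable
    (fun x hx ↦ mul_nonneg (hf.nonneg x hx.1.le) (hg.nonneg _ (sub_nonneg.mpr hx.2.le)))
    ((hf.countable.union (hg.countable.preimage (sub_right_injective (b := t)))).mono ?_)
  rintro x ⟨hx, h⟩
  rcases mul_eq_zero.mp h with h | h
  · exact Or.inl ⟨hx.1, h⟩
  · exact Or.inr ⟨sub_pos.mpr hx.2, h⟩

/-! ### The convolution formula -/

/-- Variation of constants for `y''' + ν² y' = F` with zero initial data. -/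
theorem primitive_three_eq_convolution {q : ℝ → ℝ} (hq : Continuous q) {ν : ℝ} (hν : ν ≠ 0)
    (t : ℝ) :
    primitive^[3] q t = ∫ s in (0 : ℝ)..t,
      (q s + ν ^ 2 * primitive^[2] q s) * ((1 - Real.cos (ν * (t - s))) / ν ^ 2) := by
  have hq1 := continuous_primitive hq
  have hq2 := continuous_primitive hq1
  simp only [Function.iterate_succ_apply', Function.iterate_zero_apply]
  have hlin (s : ℝ) : HasDerivAt (fun s ↦ ν * (t - s)) (-ν) s := by
    simpa using ((hasDerivAt_id s).const_sub t).const_mul ν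
  have hw (s : ℝ) : HasDerivAt (fun s ↦ (1 - Real.cos (ν * (t - s))) / ν ^ 2)
      (-(Real.sin (ν * (t - s)) / ν)) s := by
    refine (((hlin s).cos.const_sub 1).div_const (ν ^ 2)).congr_deriv ?_
    field_simp
  have hw' (s : ℝ) : HasDerivAt (fun s ↦ Real.sin (ν * (t - s)) / ν)
      (-Real.cos (ν * (t - s))) s := by
    refine ((hlin s).sin.div_const ν).congr_deriv ?_
    field_simp
  -- With `w` the kernel, `Iq·w - I²q·w' + I³q` is an antiderivative of the integrand. At `s = t`
  -- both `w` and `w'` vanish, leaving `I³q(t)`; at `s = 0` the primitives vanish.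
  have hΦ (s : ℝ) := (((hasDerivAt_primitive hq s).mul (hw s)).add
    ((hasDerivAt_primitive hq1 s).mul (hw' s))).add (hasDerivAt_primitive hq2 s)
  have hΦ' (s : ℝ) : HasDerivAt (fun s ↦ primitive q s * ((1 - Real.cos (ν * (t - s))) / ν ^ 2)
      + primitive (primitive q) s * (Real.sin (ν * (t - s)) / ν)
      + primitive (primitive (primitive q)) s)
      ((q s + ν ^ 2 * primitive (primitive q) s)
        * ((1 - Real.cos (ν * (t - s))) / ν ^ 2)) s := by
    refine (hΦ s).congr_deriv ?_
    field_simp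
    ring
  rw [intervalIntegral.integral_eq_sub_of_hasDerivAt (fun x _ ↦ hΦ' x)
    (Continuous.intervalIntegrable (by fun_prop) _ _)]
  simp [primitive_zero]

/-! ### Divided differences of cosines -/

/-- Iterated divided differences of a sequence of functions with respect to the nodes `n ^ 2`. -/
noncomputable def sqDivDiff (f : ℕ → ℝ → ℝ) : ℕ → ℕ → ℝ → ℝ
  | 0, n, θ => f n θ
  | a + 1, n, θ =>
    (sqDivDiff f a n θ - sqDivDiff f a (n + 1) θ) / (((a : ℝ) + 1) * (2 * n + a + 1))

theorem hasDerivAt_sqDivDiff {f f' : ℕ → ℝ → ℝ} {θ : ℝ} (h : ∀ n, HasDerivAt (f n) (f' n θ) θ)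
    (a n : ℕ) : HasDerivAt (sqDivDiff f a n) (sqDivDiff f' a n θ) θ := by
  induction a generalizing n with
  | zero => exact h n
  | succ a ih => exact ((ih n).sub (ih (n + 1))).div_const _

theorem continuous_sqDivDiff {f : ℕ → ℝ → ℝ} (h : ∀ n, Continuous (f n)) (a n : ℕ) :
    Continuous (sqDivDiff f a n) := by
  induction a generalizing n with
  | zero => exact h n
  | succ a ih => exact ((ih n).sub (ih (n + 1))).div_const _

theorem sqDivDiff_succ_eq_zero {f : ℕ → ℝ → ℝ} {θ c : ℝ} (h : ∀ n, f n θ = c) (a n : ℕ) :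
    sqDivDiff f (a + 1) n θ = 0 := by
  induction a generalizing n with
  | zero => simp [sqDivDiff, h]
  | succ a ih => rw [sqDivDiff, ih, ih, sub_self, zero_div]

theorem sqDivDiff_sub (f : ℕ → ℝ → ℝ) (a n : ℕ) (θ : ℝ) :
    sqDivDiff f a n θ - sqDivDiff f a (n + 1) θ
      = ((a : ℝ) + 1) * (2 * n + a + 1) * sqDivDiff f (a + 1) n θ := by
  rw [sqDivDiff]
  have : (0 : ℝ) < ((a : ℝ) + 1) * (2 * n + a + 1) := by positivity
  field_simp

/-- The Leibniz rule for divided differences of `n² · f n`: the denominators are `(n+a+1)² - n²`,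
and the last node is `(n+a+1)²`. -/
theorem sqDivDiff_eigen {f g : ℕ → ℝ → ℝ} {θ : ℝ} (h : ∀ n : ℕ, g n θ = -(n : ℝ) ^ 2 * f n θ)
    (a n : ℕ) :
    sqDivDiff g (a + 1) n θ + ((n : ℝ) + a + 1) ^ 2 * sqDivDiff f (a + 1) n θ
      = sqDivDiff f a n θ := by
  induction a generalizing n with
  | zero =>
    simp only [sqDivDiff, h]
    push_cast
    have : (0 : ℝ) < 2 * n + 1 := by positivity
    field_simp
    ring
  | succ a ih =>
    have h1 := ih n
    have h2 := ih (n + 1)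
    have h3 := sqDivDiff_sub f a n θ
    have h4 := sqDivDiff_sub f (a + 1) n θ
    have h5 := sqDivDiff_sub g (a + 1) n θ
    push_cast at h1 h2 h3 h4 h5 ⊢
    have hp : (0 : ℝ) < ((a : ℝ) + 1 + 1) * (2 * n + (a + 1) + 1) := by positivity
    refine mul_left_cancel₀ hp.ne' ?_
    linear_combination h1 - h2 + h3 - h5 - ((n : ℝ) + (a + 1) + 1) ^ 2 * h4

/-- The divided differences of the functions `cos (n θ)`. -/
noncomputable def cosDivDiff : ℕ → ℕ → ℝ → ℝ := sqDivDiff fun n θ ↦ Real.cos (n * θ)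

theorem continuous_cosDivDiff (a n : ℕ) : Continuous (cosDivDiff a n) :=
  continuous_sqDivDiff (fun n ↦ by fun_prop) a n

theorem exists_cosDivDiff_eq_primitive (a n : ℕ) :
    ∃ p : ℝ → ℝ, Continuous p ∧ primitive^[2] p = cosDivDiff (a + 1) n ∧
      ∀ θ, 1 * p θ + ((n : ℝ) + a + 1) ^ 2 * cosDivDiff (a + 1) n θ = cosDivDiff a n θ := by
  have hlin (n : ℕ) (θ : ℝ) : HasDerivAt (fun θ ↦ (n : ℝ) * θ) n θ := by
    simpa using (hasDerivAt_id θ).const_mul (n : ℝ)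
  have h1 (n : ℕ) (θ : ℝ) : HasDerivAt (fun θ ↦ Real.cos (n * θ)) (-n * Real.sin (n * θ)) θ :=
    (hlin n θ).cos.congr_deriv (by ring)
  have h2 (n : ℕ) (θ : ℝ) : HasDerivAt (fun θ ↦ -n * Real.sin (n * θ))
      (-(n : ℝ) ^ 2 * Real.cos (n * θ)) θ :=
    ((hlin n θ).sin.const_mul (-(n : ℝ))).congr_deriv (by ring)
  refine ⟨sqDivDiff (fun n θ ↦ -(n : ℝ) ^ 2 * Real.cos (n * θ)) (a + 1) n,
    continuous_sqDivDiff (fun n ↦ by fun_prop) _ _, ?_, fun θ ↦ ?_⟩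
  · simp only [Function.iterate_succ_apply', Function.iterate_zero_apply]
    rw [primitive_deriv (fun t ↦ hasDerivAt_sqDivDiff (fun n ↦ h2 n t) (a + 1) n)
      (continuous_sqDivDiff (fun n ↦ by fun_prop) _ _)
      (sqDivDiff_succ_eq_zero (c := 0) (by simp) _ _)]
    exact primitive_deriv (fun t ↦ hasDerivAt_sqDivDiff (fun n ↦ h1 n t) (a + 1) n)
      (continuous_sqDivDiff (fun n ↦ by fun_prop) _ _)
      (sqDivDiff_succ_eq_zero (c := 1) (by simp) _ _)
  · rw [one_mul]
    exact sqDivDiff_eigen (fun _ ↦ rfl) a n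

theorem primitive_cosDivDiff_succ (a n : ℕ) (t : ℝ) :
    primitive^[a + 3] (cosDivDiff (a + 1) n) t = ∫ s in (0 : ℝ)..t,
      primitive^[a + 2] (cosDivDiff a n) s
        * ((1 - Real.cos (((n : ℝ) + a + 1) * (t - s))) / ((n : ℝ) + a + 1) ^ 2) := by
  obtain ⟨p, hp, h2, h⟩ := exists_cosDivDiff_eq_primitive a n
  have hν : (n : ℝ) + a + 1 ≠ 0 := by positivity
  -- Since `I² p = D_{a+1}`, the convolution formula applies to `q = I^{a+2} p`, for which `q + ν²
  -- I² q = I^{a+2} D_a`.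
  rw [show primitive^[a + 3] (cosDivDiff (a + 1) n) = primitive^[3] (primitive^[a + 2] p) by
      rw [← h2, ← Function.iterate_add_apply, ← Function.iterate_add_apply,
        show a + 3 + 2 = 3 + (a + 2) by ring],
    primitive_three_eq_convolution (continuous_primitive_iterate hp _) hν]
  have hsum := primitive_iterate_lincomb hp (continuous_cosDivDiff (a + 1) n) 1
    (((n : ℝ) + a + 1) ^ 2) (a + 2)
  rw [funext h] at hsum
  rw [hsum, ← h2, ← Function.iterate_add_apply, ← Function.iterate_add_apply, add_comm 2 (a + 2)]
  simp only [one_mul]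

theorem primitive_two_cos_zero : primitive^[2] (cosDivDiff 0 0) = fun t ↦ t ^ 2 / 2 := by
  simp only [Function.iterate_succ_apply', Function.iterate_zero_apply]
  have h : cosDivDiff 0 0 = fun _ ↦ (1 : ℝ) := by ext; simp [cosDivDiff, sqDivDiff]
  rw [h, primitive_deriv (f := fun t ↦ t) hasDerivAt_id' continuous_const rfl]
  refine primitive_deriv (fun t ↦ ?_) continuous_id (by simp)
  exact (((hasDerivAt_id' t).pow 2).div_const 2).congr_deriv (by simp)

theorem primitive_two_cos {n : ℕ} (hn : n ≠ 0) :
    primitive^[2] (cosDivDiff 0 n) = fun t ↦ (1 - Real.cos (n * t)) / (n : ℝ) ^ 2 := by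
  simp only [Function.iterate_succ_apply', Function.iterate_zero_apply]
  have hn : (n : ℝ) ≠ 0 := Nat.cast_ne_zero.mpr hn
  have hlin (θ : ℝ) : HasDerivAt (fun θ ↦ (n : ℝ) * θ) n θ := by
    simpa using (hasDerivAt_id θ).const_mul (n : ℝ)
  rw [primitive_deriv (f := fun t ↦ Real.sin (n * t) / n)
    (fun t ↦ ((hlin t).sin.div_const _).congr_deriv ?_) (continuous_cosDivDiff _ _) (by simp)]
  · refine primitive_deriv (fun t ↦ ?_) (by fun_prop) (by simp)
    refine (((hlin t).cos.const_sub 1).div_const _).congr_deriv ?_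
    field_simp
  · simp only [cosDivDiff, sqDivDiff]
    field_simp

theorem essPos_primitive_cosDivDiff_zero (n : ℕ) : EssPos (primitive^[2] (cosDivDiff 0 n)) := by
  rcases eq_or_ne n 0 with rfl | hn
  · rw [primitive_two_cos_zero]
    exact .of_pos (by fun_prop) (by simp) fun t ht ↦ by positivity
  · rw [primitive_two_cos hn]
    exact essPos_one_sub_cos (Nat.cast_ne_zero.mpr hn)

theorem essPos_primitive_cosDivDiff (a n : ℕ) :
    EssPos (primitive^[a + 2] (cosDivDiff a n)) ∧
      (a ≠ 0 → ∀ t, 0 < t → 0 < primitive^[a + 2] (cosDivDiff a n) t) := by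
  induction a with
  | zero => exact ⟨essPos_primitive_cosDivDiff_zero n, fun h ↦ (h rfl).elim⟩
  | succ a ih =>
    have hν : (n : ℝ) + a + 1 ≠ 0 := by positivity
    have h (t : ℝ) (ht : 0 < t) : 0 < primitive^[a + 1 + 2] (cosDivDiff (a + 1) n) t := by
      rw [show a + 1 + 2 = a + 3 by ring, primitive_cosDivDiff_succ]
      exact ih.1.convolution_pos (essPos_one_sub_cos hν) ht
    refine ⟨.of_pos (continuous_primitive_iterate (continuous_cosDivDiff _ _) _) ?_ h, fun _ ↦ h⟩
    rw [Function.iterate_succ_apply', primitive_zero]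

/-! ### Weighted Jacobi polynomials -/

/-- The weighted Jacobi polynomial
`P_n^{(α-1/2,β-1/2)}(cos θ) (sin θ/2)^{2α} (cos θ/2)^{2β}`. -/
noncomputable def jacobiWeighted (α β n : ℕ) (θ : ℝ) : ℝ :=
  jacobiP n ((α : ℝ) - 1 / 2) ((β : ℝ) - 1 / 2) (Real.cos θ)
    * Real.sin (θ / 2) ^ (2 * α) * Real.cos (θ / 2) ^ (2 * β)

theorem continuous_jacobiWeighted (α β n : ℕ) : Continuous (jacobiWeighted α β n) := by
  unfold jacobiWeighted jacobiP
  fun_prop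

theorem jacobiIntegral_eq_fracIntegral (α β n : ℕ) (δ t : ℝ) :
    jacobiIntegral α β δ n t = fracIntegral δ (jacobiWeighted α β n) t := by
  simp only [jacobiIntegral, fracIntegral, jacobiWeighted, mul_assoc]

theorem jacobiWeighted_succ_left (α β n : ℕ) (θ : ℝ) :
    (2 * (n : ℝ) + α + β + 1) * jacobiWeighted (α + 1) β n θ
      = (n + α + 1 / 2) * jacobiWeighted α β n θ - (n + 1) * jacobiWeighted α β (n + 1) θ := by
  have h := jacobiP_contiguous_left n ((α : ℝ) - 1 / 2) ((β : ℝ) - 1 / 2) (Real.cos θ)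
  have hs : Real.sin (θ / 2) ^ 2 = (1 - Real.cos θ) / 2 := by
    rw [Real.sin_sq_eq_half_sub, mul_div_cancel₀ θ two_ne_zero]; ring
  rw [← hs] at h
  simp only [jacobiWeighted]
  push_cast
  rw [show (α : ℝ) + 1 - 1 / 2 = α - 1 / 2 + 1 by ring]
  linear_combination Real.sin (θ / 2) ^ (2 * α) * Real.cos (θ / 2) ^ (2 * β) * h

theorem jacobiWeighted_succ_right (α β n : ℕ) (θ : ℝ) :
    (2 * (n : ℝ) + α + β + 1) * jacobiWeighted α (β + 1) n θ
      = (n + β + 1 / 2) * jacobiWeighted α β n θ + (n + 1) * jacobiWeighted α β (n + 1) θ := by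
  have h := jacobiP_contiguous_right n ((α : ℝ) - 1 / 2) ((β : ℝ) - 1 / 2) (Real.cos θ)
  have hs : Real.cos (θ / 2) ^ 2 = (1 + Real.cos θ) / 2 := by
    rw [Real.cos_sq, mul_div_cancel₀ θ two_ne_zero]; ring
  rw [← hs] at h
  simp only [jacobiWeighted]
  push_cast
  rw [show (β : ℝ) + 1 - 1 / 2 = β - 1 / 2 + 1 by ring]
  linear_combination Real.sin (θ / 2) ^ (2 * α) * Real.cos (θ / 2) ^ (2 * β) * h

/-- The normalising constants satisfy `(n + α + 1/2) c_n = (n + 1) c_{n+1}`, so the contiguous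
relation becomes a pure difference in `n`. -/
theorem jacobiWeighted_zero_right (α n : ℕ) (θ : ℝ) :
    jacobiWeighted α 0 n θ = α.factorial * (ascPochhammer ℝ (n + α)).eval (1 / 2 : ℝ) / n.factorial
      * cosDivDiff α n θ := by
  induction α generalizing n with
  | zero =>
    have h := jacobiP_neg_half n (Real.cos θ)
    rw [Polynomial.Chebyshev.T_real_cos] at h
    simp only [jacobiWeighted, cosDivDiff, sqDivDiff]
    simpa using h
  | succ α ih =>
    have h := jacobiWeighted_succ_left α 0 n θ
    have hd := sqDivDiff_sub (fun n θ ↦ Real.cos (n * θ)) α n θ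
    rw [ih, ih, show n + 1 + α = n + α + 1 by ring, ascPochhammer_succ_eval] at h
    rw [← add_assoc n, ascPochhammer_succ_eval]
    simp only [Nat.factorial_succ, cosDivDiff] at h ⊢
    push_cast at h ⊢
    have := Nat.factorial_pos n
    have hp : (0 : ℝ) < 2 * n + α + 1 := by positivity
    generalize (ascPochhammer ℝ (n + α)).eval (1 / 2 : ℝ) = q at *
    field_simp at h ⊢
    refine mul_left_cancel₀ hp.ne' ?_
    linear_combination h + α.factorial * q * (2 * (n + α) + 1) * hd

theorem primitive_iterate_const_mul {f : ℝ → ℝ} (hf : Continuous f) (c : ℝ) (m : ℕ) :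
    primitive^[m] (fun x ↦ c * f x) = fun x ↦ c * primitive^[m] f x := by
  simpa using primitive_iterate_lincomb hf hf c 0 m

theorem primitive_jacobiWeighted_zero_right (α n : ℕ) :
    ∃ c : ℝ, 0 < c ∧ primitive^[α + 2] (jacobiWeighted α 0 n)
      = fun t ↦ c * primitive^[α + 2] (cosDivDiff α n) t := by
  refine ⟨_, ?_, (congrArg _ (funext (jacobiWeighted_zero_right α n))).trans
    (primitive_iterate_const_mul (continuous_cosDivDiff α n) _ _)⟩
  have := ascPochhammer_pos (S := ℝ) (n + α) (1 / 2) (by norm_num)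
  have := Nat.factorial_pos n
  have := Nat.factorial_pos α
  positivity

theorem primitive_jacobiWeighted_succ_right (α β n : ℕ) :
    ∃ c d : ℝ, 0 < c ∧ 0 < d ∧ primitive^[α + 2] (jacobiWeighted α (β + 1) n)
      = fun t ↦ c * primitive^[α + 2] (jacobiWeighted α β n) t
        + d * primitive^[α + 2] (jacobiWeighted α β (n + 1)) t := by
  have hp : (0 : ℝ) < 2 * n + α + β + 1 := by positivity
  refine ⟨(n + β + 1 / 2) / (2 * n + α + β + 1), (n + 1) / (2 * n + α + β + 1),
    by positivity, by positivity, ?_⟩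
  rw [← primitive_iterate_lincomb (continuous_jacobiWeighted _ _ _)
    (continuous_jacobiWeighted _ _ _)]
  congr 1
  ext θ
  have := jacobiWeighted_succ_right α β n θ
  field_simp
  linear_combination 2 * this

theorem essPos_primitive_jacobiWeighted (α β n : ℕ) :
    EssPos (primitive^[α + 2] (jacobiWeighted α β n)) := by
  induction β generalizing n with
  | zero =>
    obtain ⟨c, hc, h⟩ := primitive_jacobiWeighted_zero_right α n
    have hV := (essPos_primitive_cosDivDiff α n).1
    rw [h]
    simpa using hV.add_mul hV hc le_rfl
  | succ β ih =>
    obtain ⟨c, d, hc, hd, h⟩ := primitive_jacobiWeighted_succ_right α β n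
    rw [h]
    exact (ih n).add_mul (ih (n + 1)) hc hd.le

theorem primitive_jacobiWeighted_pos {α : ℕ} (hα : α ≠ 0) (β n : ℕ) {t : ℝ} (ht : 0 < t) :
    0 < primitive^[α + 2] (jacobiWeighted α β n) t := by
  induction β generalizing n with
  | zero =>
    obtain ⟨c, hc, h⟩ := primitive_jacobiWeighted_zero_right α n
    rw [h]
    exact mul_pos hc ((essPos_primitive_cosDivDiff α n).2 hα t ht)
  | succ β ih =>
    obtain ⟨c, d, hc, hd, h⟩ := primitive_jacobiWeighted_succ_right α β n
    rw [h]
    exact add_pos (mul_pos hc (ih n)) (mul_pos hd (ih (n + 1)))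

/-! ### Strict positivity for `α = 0` -/

theorem cos_eq_one_of_consecutive {x y : ℝ} (h1 : Real.cos y = 1) (h2 : Real.cos (y + x) = 1) :
    Real.cos x = 1 := by
  have hs : Real.sin y = 0 := by
    have := Real.sin_sq_add_cos_sq y
    rw [h1] at this
    nlinarith
  simpa [Real.cos_add, h1, hs] using h2

/-- For `n ≥ 1`, `1 - cos nt` and `1 - cos (n+1)t` vanish together only when `cos t = 1`; for `n =
0` the first term is a multiple of `t²`. -/
theorem primitive_cos_add_pos {n : ℕ} {t : ℝ} (ht : 0 < t)
    (h : ¬ (1 ≤ n ∧ ∃ k : ℕ, t = 2 * Real.pi * (k : ℝ))) {c d : ℝ} (hc : 0 < c) (hd : 0 < d) :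
    0 < c * primitive^[2] (cosDivDiff 0 n) t + d * primitive^[2] (cosDivDiff 0 (n + 1)) t := by
  have h1 := (essPos_primitive_cosDivDiff_zero n).nonneg t ht.le
  have h2 := (essPos_primitive_cosDivDiff_zero (n + 1)).nonneg t ht.le
  rcases eq_or_ne n 0 with rfl | hn
  · refine add_pos_of_pos_of_nonneg (mul_pos hc ?_) (mul_nonneg hd.le h2)
    rw [primitive_two_cos_zero]
    positivity
  · by_contra hneg
    have m1 := mul_nonneg hc.le h1
    have m2 := mul_nonneg hd.le h2
    have z1 := (mul_eq_zero.mp (by linarith : c * primitive^[2] (cosDivDiff 0 n) t = 0)).resolve_left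
      hc.ne'
    have z2 := (mul_eq_zero.mp
      (by linarith : d * primitive^[2] (cosDivDiff 0 (n + 1)) t = 0)).resolve_left hd.ne'
    rw [primitive_two_cos hn] at z1
    rw [primitive_two_cos n.succ_ne_zero] at z2
    have c1 := (div_eq_zero_iff.mp z1).resolve_right (by positivity)
    have c2 := (div_eq_zero_iff.mp z2).resolve_right (by positivity)
    push_cast at c2
    rw [add_mul, one_mul] at c2
    obtain ⟨k, hk⟩ := (Real.cos_eq_one_iff t).mp
      (cos_eq_one_of_consecutive (y := n * t) (by linarith) (by linarith))
    have hk0 : 0 ≤ k := by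
      by_contra hk'
      have : (k : ℝ) < 0 := by exact_mod_cast not_le.mp hk'
      have := mul_neg_of_neg_of_pos this Real.two_pi_pos
      linarith
    lift k to ℕ using hk0
    exact h ⟨Nat.one_le_iff_ne_zero.mpr hn, k, by rw [← hk]; push_cast; ring⟩

/-- The step from `β = 0` to `1` mixes the frequencies `n` and `n + 1`. Later steps keep the same
`n` in the strictly positive term, so the excluded set does not change. -/
theorem primitive_jacobiWeighted_zero_left_pos {β n : ℕ} (hβ : β ≠ 0) {t : ℝ} (ht : 0 < t)
    (h : ¬ (1 ≤ n ∧ ∃ k : ℕ, t = 2 * Real.pi * (k : ℝ))) :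
    0 < primitive^[2] (jacobiWeighted 0 β n) t := by
  obtain ⟨β, rfl⟩ := Nat.exists_eq_succ_of_ne_zero hβ
  clear hβ
  induction β with
  | zero =>
    obtain ⟨c, d, hc, hd, e⟩ := primitive_jacobiWeighted_succ_right 0 0 n
    obtain ⟨c', hc', e'⟩ := primitive_jacobiWeighted_zero_right 0 n
    obtain ⟨d', hd', e''⟩ := primitive_jacobiWeighted_zero_right 0 (n + 1)
    simp only [zero_add] at e e' e''
    change 0 < primitive^[2] (jacobiWeighted 0 1 n) t
    rw [e, e', e'']
    have := primitive_cos_add_pos ht h (mul_pos hc hc') (mul_pos hd hd')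
    simpa only [mul_assoc] using this
  | succ β ih =>
    obtain ⟨c, d, hc, hd, e⟩ := primitive_jacobiWeighted_succ_right 0 (β + 1) n
    have h2 := (essPos_primitive_jacobiWeighted 0 (β + 1) (n + 1)).nonneg t ht.le
    simp only [zero_add] at e h2
    rw [e]
    exact add_pos_of_pos_of_nonneg (mul_pos hc ih) (mul_nonneg hd.le h2)

/-! ### Back to the integrals -/

theorem jacobiIntegral_pos_of_lt {α β n : ℕ} {δ t : ℝ} (hδ : (α : ℝ) + 1 < δ) (ht : 0 < t) :
    0 < jacobiIntegral α β δ n t := by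
  have hε : -1 < δ - (α + 2 : ℕ) := by push_cast; linarith
  obtain ⟨C, hC, h⟩ := exists_fracIntegral_add_nat hε (α + 2)
  rw [jacobiIntegral_eq_fracIntegral, ← sub_add_cancel δ (α + 2 : ℕ),
    h _ (continuous_jacobiWeighted α β n) t ht.le]
  exact mul_pos hC ((essPos_primitive_jacobiWeighted α β n).fracIntegral_pos hε ht)

theorem exists_jacobiIntegral_eq_primitive (α : ℕ) :
    ∃ C : ℝ, 0 < C ∧ ∀ (β n : ℕ) (t : ℝ), 0 ≤ t →
      jacobiIntegral α β (α + 1) n t = C * primitive^[α + 2] (jacobiWeighted α β n) t := by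
  -- Only `α + 1` integrations by parts are used: the remaining integral with exponent `0` supplies
  -- the last primitive.
  obtain ⟨C, hC, h⟩ := exists_fracIntegral_add_nat (ε := 0) (by norm_num) (α + 1)
  refine ⟨C, hC, fun β n t ht ↦ ?_⟩
  have h := h _ (continuous_jacobiWeighted α β n) t ht
  rw [fracIntegral_zero, ← Function.iterate_succ_apply' primitive] at h
  rw [jacobiIntegral_eq_fracIntegral, ← h]
  push_cast
  rw [zero_add]

theorem gegenbauerIntegral_eq_jacobiIntegral (lam n : ℕ) (hlam : 1 ≤ lam) (δ t : ℝ) :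
    ∃ C : ℝ, 0 < C ∧ gegenbauerIntegral lam δ n t = C * jacobiIntegral lam lam δ n t := by
  have hl : (0 : ℝ) < lam := by exact_mod_cast hlam
  have h1 := ascPochhammer_pos (S := ℝ) n (2 * lam) (by positivity)
  have h2 := ascPochhammer_pos (S := ℝ) n (lam + 1 / 2) (by positivity)
  refine ⟨(ascPochhammer ℝ n).eval (2 * (lam : ℝ)) / (ascPochhammer ℝ n).eval (lam + 1 / 2 : ℝ)
    * 4 ^ lam, by positivity, ?_⟩
  rw [gegenbauerIntegral, jacobiIntegral, ← intervalIntegral.integral_const_mul]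
  congr 1
  ext θ
  have hθ : Real.sin θ = 2 * Real.sin (θ / 2) * Real.cos (θ / 2) := by
    rw [← Real.sin_two_mul, mul_div_cancel₀ θ two_ne_zero]
  have hs : Real.sin θ ^ (2 * (lam : ℝ))
      = 4 ^ lam * Real.sin (θ / 2) ^ (2 * lam) * Real.cos (θ / 2) ^ (2 * lam) := by
    rw [show 2 * (lam : ℝ) = (2 * lam : ℕ) by push_cast; ring, Real.rpow_natCast,
      hθ, mul_pow, mul_pow, pow_mul 2]
    norm_num
  rw [hs, gegenbauerC_eq_jacobiP n lam _ hl]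
  ring

theorem theorem2p1 :
    (∀ (α β : ℕ) (δ : ℝ) (n : ℕ) (t : ℝ),
      ¬ (α = 0 ∧ β = 0) → (α : ℝ) + 1 ≤ δ → 0 < t →
      ¬ (α = 0 ∧ δ = 1 ∧ 1 ≤ n ∧ ∃ k : ℕ, t = 2 * Real.pi * (k : ℝ)) →
        0 < jacobiIntegral α β δ n t) ∧
    (∀ (δ : ℝ) (n : ℕ) (t : ℝ), 1 ≤ δ → 0 < t → 0 ≤ jacobiIntegral 0 0 δ n t) ∧
    (∀ (lam : ℕ) (δ : ℝ) (n : ℕ) (t : ℝ),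
      1 ≤ lam → (lam : ℝ) + 1 ≤ δ → 0 < t → t ≤ Real.pi →
        0 < gegenbauerIntegral (lam : ℝ) δ n t) := by
  have h1 : ∀ (α β : ℕ) (δ : ℝ) (n : ℕ) (t : ℝ),
      ¬ (α = 0 ∧ β = 0) → (α : ℝ) + 1 ≤ δ → 0 < t →
      ¬ (α = 0 ∧ δ = 1 ∧ 1 ≤ n ∧ ∃ k : ℕ, t = 2 * Real.pi * (k : ℝ)) →
        0 < jacobiIntegral α β δ n t := by
    intro α β δ n t h0 hδ ht h
    rcases hδ.lt_or_eq with hδ | rfl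
    · exact jacobiIntegral_pos_of_lt hδ ht
    obtain ⟨C, hC, e⟩ := exists_jacobiIntegral_eq_primitive α
    rw [e β n t ht.le]
    refine mul_pos hC ?_
    rcases eq_or_ne α 0 with rfl | hα
    · exact primitive_jacobiWeighted_zero_left_pos (fun hβ ↦ h0 ⟨rfl, hβ⟩) ht
        fun h' ↦ h ⟨rfl, by simp, h'⟩
    · exact primitive_jacobiWeighted_pos hα β n ht
  refine ⟨h1, fun δ n t hδ ht ↦ ?_, fun lam δ n t hlam hδ ht _ ↦ ?_⟩
  · rcases hδ.lt_or_eq with hδ | rfl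
    · exact (jacobiIntegral_pos_of_lt (by simpa using hδ) ht).le
    · obtain ⟨C, hC, e⟩ := exists_jacobiIntegral_eq_primitive 0
      have e := e 0 n t ht.le
      simp only [Nat.cast_zero, zero_add] at e
      rw [e]
      exact mul_nonneg hC.le ((essPos_primitive_jacobiWeighted 0 0 n).nonneg t ht.le)
  · obtain ⟨C, hC, e⟩ := gegenbauerIntegral_eq_jacobiIntegral lam n hlam δ t
    rw [e]
    exact mul_pos hC (h1 lam lam δ n t (by omega) hδ ht fun h ↦ by omega)
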